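/- For every $m\ge 1$ let $n=n(m)\ge 2$, and let $X_1,\dots,X_n$ be i.i.d. random vectors in $\mathbb R^m$, $X_j=(X_{1,j},\dots,X_{m,j})$, whose coordinates have the marginal laws $X_{i,j}\sim N(\mu_i,\sigma^2)$; the $m$ coordinates of a vector may be arbitrarily dependent. Here $\sigma^2>0$ is a fixed unknown constant, the same for all $m$, while the $\mu_i$ (and the probability space) may depend on $m$. Consider the hypotheses $H_i:\mu_i=0$, put $I_{m,0}=\{i\le m:\mu_i=0\}$, and let $$S_{n,i}=\sum_{j=1}^n X_{i,j}^2,\qquad T_{n,i}=\frac{\sqrt n\,\overline X_{n,i}}{\hat\sigma_{n,i}},$$ where $\overline X_{n,i}$ and $\hat\sigma^2_{n,i}$ are the sample mean and the unbiased sample variance of $X_{i,1},\dots,X_{i,n}$. Fix $0<\gamma\le 1$ and $0<\alpha<1$, and let $u=\chi^2_n(1-m^{\gamma-1})$ be the $(1-m^{\gamma-1})$-quantile of the chi-squared distribution with $n$ degrees of freedom ($u=0$ if $\gamma=1$). Let $\hat\sigma^2$ be an estimator (a random variable, for each $m$) of $\sigma^2$. The modified two-stage procedure selects the hypotheses in $\hat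 I_n=\{i: S_{n,i}>\hat\sigma^2u\}$ and rejects $H_i$ if and only if $i\in\hat I_n$ and $|T_{n,i}|>t_{n-1}\bigl(1-\tfrac{\alpha}{2|\hat I_n|}\bigr)$, where $t_{n-1}(p)$ is the $p$-quantile of Student's $t$-distribution with $n-1$ degrees of freedom. Its familywise error rate $\mathrm{FWER}_m$ is the probability that at least one $H_i$ with $i\in I_{m,0}$ is rejected. For real $c$ let $\hat S_{n,0}(c)=\{i\in I_{m,0}: S_{n,i}>c\,\sigma^2u\}$. Assume that, as $m\to\infty$, (B1) $|I_{m,0}|/m\to\pi_0$ for a constant $0<\pi_0\le 1$; (B3) $\hat\sigma^2-\sigma^2=O_P\bigl(1/\sqrt{mn}\bigr)$; (B4) $|\hat S_{n,0}(1-\delta_m)|/m^\gamma\to\pi_0$ in probability, where $\delta_m=\tau_m/\sqrt{mn}$ for some real sequence $\tau_m\to\infty$ that grows slowly, in the sense that $\tau_m\log m/\sqrt m\to 0$. Then the modified two-stage procedure asymptotically controls the familywise error rate at level $\alpha$: $$\limsup_{m\to\infty}\mathrm{FWER}_m\le\alpha .$$ -/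

import Mathlib

open MeasureTheory ProbabilityTheory Filter Topology
open scoped NNReal ENNReal

noncomputable section

namespace TwoStage

/-- The chi-squared distribution with `k` degrees of freedom: the law of the sum of the squares of
`k` independent standard normal variables. -/
def chiSquared (k : ℕ) : Measure ℝ :=
  (Measure.pi fun _ : Fin k => gaussianReal 0 1).map fun z => ∑ j, z j ^ 2

/-- Student's t-distribution with `k` degrees of freedom (`1 ≤ k`): the law of `Z / √(V / k)` with
`Z` standard normal, `V` chi-squared with `k` degrees of freedom, and `Z`, `V` independent. -/
def studentT (k : ℕ) : Measure ℝ :=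
  ((gaussianReal 0 1).prod (chiSquared k)).map fun p => p.1 / √(p.2 / k)

/-- The `p`-quantile of a probability law on the line: the least `x` with `F x ≥ p`. For `p = 0` the
value is the real-number convention `sInf univ = 0`, which is the lower endpoint of the support of
every chi-squared law of positive degree. -/
def quantile (ν : Measure ℝ) (p : ℝ) : ℝ :=
  sInf {x : ℝ | p ≤ cdf ν x}

section Statistics

variable {n : ℕ}

/-- Sum of squares of a sample. -/
def sumSq (x : Fin n → ℝ) : ℝ := ∑ j, x j ^ 2

/-- Sample mean. -/
def sampleMean (x : Fin n → ℝ) : ℝ := (∑ j, x j) / n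

/-- Unbiased sample variance (`2 ≤ n`). -/
def sampleVar (x : Fin n → ℝ) : ℝ := (∑ j, (x j - sampleMean x) ^ 2) / ((n : ℝ) - 1)

/-- The t-statistic for testing that the mean is zero. -/
def tStat (x : Fin n → ℝ) : ℝ := √(n : ℝ) * sampleMean x / √(sampleVar x)

end Statistics

/-- `X i j` (`i` a population, `j` an observation) is a sample of `n` independent and identically
distributed random vectors `(X i j)_i` in `ℝ^m` such that each coordinate `X i j` is
`N(μ i, σ²)`. The joint law of the coordinates of one vector is otherwise arbitrary. -/
structure IsSample {Ω : Type*} [MeasurableSpace Ω] (P : Measure Ω) {m n : ℕ}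
    (X : Fin m → Fin n → Ω → ℝ) (μ : Fin m → ℝ) (σ : ℝ) : Prop where
  measurable : ∀ i j, Measurable (X i j)
  indep : iIndepFun (fun (j : Fin n) (ω : Ω) (i : Fin m) => X i j ω) P
  identDistrib : ∀ j j' : Fin n,
    IdentDistrib (fun (ω : Ω) (i : Fin m) => X i j ω) (fun (ω : Ω) (i : Fin m) => X i j' ω) P P
  gaussian : ∀ i j, HasLaw (X i j) (gaussianReal (μ i) (σ ^ 2).toNNReal) P

section Procedure

variable {m n : ℕ}

open Classical in
/-- The set of (indices of) true null hypotheses `μ i = 0`. -/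
def trueNulls (μ : Fin m → ℝ) : Finset (Fin m) := Finset.univ.filter fun i => μ i = 0

/-- The selection threshold `u`: the quantile of order `1 - m ^ (γ - 1)` of the chi-squared law
with `n` degrees of freedom. -/
def selThreshold (m n : ℕ) (γ : ℝ) : ℝ := quantile (chiSquared n) (1 - (m : ℝ) ^ (γ - 1))

open Classical in
/-- The indices whose sum of squares exceeds the cutoff `c`. -/
def selected (x : Fin m → Fin n → ℝ) (c : ℝ) : Finset (Fin m) :=
  Finset.univ.filter fun i => c < sumSq (x i)

open Classical in
/-- The hypotheses rejected by the two-stage procedure with estimated variance `s`: those which are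
selected (sum of squares exceeds `s * u`) and whose absolute t-statistic exceeds the quantile of
order `1 - α / (2 |selected|)` of the t-distribution with `n - 1` degrees of freedom. -/
def rejected (γ α : ℝ) (x : Fin m → Fin n → ℝ) (s : ℝ) : Finset (Fin m) :=
  (selected x (s * selThreshold m n γ)).filter fun i =>
    quantile (studentT (n - 1))
      (1 - α / (2 * ((selected x (s * selThreshold m n γ)).card : ℝ))) < |tStat (x i)|

open Classical in
/-- The number of true nulls whose sum of squares exceeds `c * σ² * u`. -/
def selectedTrueNulls (γ : ℝ) (μ : Fin m → ℝ) (σ c : ℝ) (x : Fin m → Fin n → ℝ) : ℕ :=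
  (trueNulls μ ∩ selected x (c * σ ^ 2 * selThreshold m n γ)).card

/-- The familywise error rate: the probability of rejecting at least one true null. -/
def FWER {Ω : Type*} [MeasurableSpace Ω] (P : Measure Ω) (γ α : ℝ) (μ : Fin m → ℝ)
    (X : Fin m → Fin n → Ω → ℝ) (sigmaSqHat : Ω → ℝ) : ℝ≥0∞ :=
  P {ω | ∃ i ∈ trueNulls μ, i ∈ rejected γ α (fun i j => X i j ω) (sigmaSqHat ω)}

end Procedure

section Asymptotics

variable {Ω : ℕ → Type*} [∀ m, MeasurableSpace (Ω m)]

/-- `Y m = O_P(r m)` as `m → ∞`, where `Y m` may live on a space depending on `m`. -/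
def IsBigOP (P : ∀ m, Measure (Ω m)) (Y : ∀ m, Ω m → ℝ) (r : ℕ → ℝ) : Prop :=
  ∀ ε : ℝ, 0 < ε → ∃ M : ℝ, ∀ᶠ m in atTop, P m {ω | M * r m < |Y m ω|} ≤ ENNReal.ofReal ε

/-- `Y m → c` in probability as `m → ∞`, where `Y m` may live on a space depending on `m`. -/
def TendstoInProb (P : ∀ m, Measure (Ω m)) (Y : ∀ m, Ω m → ℝ) (c : ℝ) : Prop :=
  ∀ ε : ℝ, 0 < ε → Tendsto (fun m => P m {ω | ε ≤ |Y m ω - c|}) atTop (𝓝 0)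

end Asymptotics

end TwoStage

end

noncomputable section

namespace TwoStage

/-! Across hypotheses only Markov's inequality and the union bound are used, so the dependence
between coordinates is irrelevant and only the law of a single null row matters. That row is `σ`
times a standard normal vector, and `tStat` is invariant under positive scaling. Rejection by the
t-test is therefore a cone event, independent of `sumSq` by `stdNormal_cone_inter`, hence of
selection at a deterministic cutoff. A null passes both stages with probability at most the
selection probability times the level of the t-test (`stdNormal_tStat_le`).

The actual cutoff and the Bonferroni divisor are random. With `δ = τ / √(m n)`, `hB3` traps the
cutoff between the factors `1 - δ` and `1 + δ`, with probability tending to one. Selection at `1 -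
δ` limits which nulls can be rejected; selection at `1 + δ` bounds the divisor from below. By `hB4`
about `π₀ m ^ γ` nulls are selected at `1 - δ`, and few of them are lost at `1 + δ`:
`stdNormal_tail_shrink_le` and `le_stdNormal_tail_enlarge` control the relative change of the tail
probability uniformly in `n`. Both rest on `P(S > a u) = a ^ (n / 2) E[exp ((1 - a) S / 2); S > u]`
and on log-convexity of exponential moments.

`IsSample.FWER_le` assembles the pieces: about `π₀ m` nulls, each selected with probability about `m
^ (γ - 1)` and tested at level about `α / (π₀ m ^ γ)`, contribute `α` in the limit. -/

/-- The law of a vector of `n` independent standard normal variables. -/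
abbrev stdNormal (n : ℕ) : Measure (Fin n → ℝ) := Measure.pi fun _ => gaussianReal 0 1

/-! ### Measurability and scaling of the statistics -/

lemma measurable_sumSq {n : ℕ} : Measurable (sumSq (n := n)) := by
  unfold sumSq; fun_prop

lemma measurable_tStat {n : ℕ} : Measurable (tStat (n := n)) := by
  unfold tStat sampleVar sampleMean; fun_prop

lemma sumSq_nonneg {n : ℕ} (x : Fin n → ℝ) : 0 ≤ sumSq x :=
  Finset.sum_nonneg fun _ _ => sq_nonneg _

lemma sumSq_smul {n : ℕ} (c : ℝ) (x : Fin n → ℝ) : sumSq (c • x) = c ^ 2 * sumSq x := by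
  simp [sumSq, mul_pow, Finset.mul_sum]

lemma tStat_smul {n : ℕ} {c : ℝ} (hc : 0 < c) (x : Fin n → ℝ) : tStat (c • x) = tStat x := by
  have h1 : sampleMean (c • x) = c * sampleMean x := by
    simp [sampleMean, ← Finset.mul_sum, mul_div_assoc]
  have h2 : sampleVar (c • x) = c ^ 2 * sampleVar x := by
    simp [sampleVar, h1, ← mul_sub, mul_pow, ← Finset.mul_sum, mul_div_assoc]
  rw [tStat, tStat, h1, h2, Real.sqrt_mul (sq_nonneg c), Real.sqrt_sq hc.le, mul_left_comm,
    mul_div_mul_left _ _ hc.ne']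

/-! ### Change of scale for the standard normal law -/

lemma gaussianReal_inv_eq_withDensity {a : ℝ} (ha : 0 < a) :
    gaussianReal 0 (a⁻¹).toNNReal = (gaussianReal 0 1).withDensity
      (fun x => ENNReal.ofReal (√a * Real.exp ((1 - a) / 2 * x ^ 2))) := by
  have ha' : (a⁻¹).toNNReal ≠ 0 := by simpa using ha
  rw [gaussianReal_of_var_ne_zero _ ha', gaussianReal_of_var_ne_zero _ one_ne_zero,
    ← withDensity_mul _ (measurable_gaussianPDF 0 1) (by fun_prop)]
  congr 1
  ext x
  simp only [Pi.mul_apply, gaussianPDF]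
  rw [← ENNReal.ofReal_mul (gaussianPDFReal_nonneg _ _ _)]
  congr 1
  simp only [gaussianPDFReal, Real.coe_toNNReal _ (inv_pos.2 ha).le, NNReal.coe_one]
  rw [Real.sqrt_mul (by positivity), Real.sqrt_mul (by positivity), Real.sqrt_inv]
  have h : Real.exp (-(x - 0) ^ 2 / (2 * a⁻¹))
      = Real.exp (-(x - 0) ^ 2 / (2 * 1)) * Real.exp ((1 - a) / 2 * x ^ 2) := by
    rw [← Real.exp_add]; congr 1; field_simp; ring
  rw [h]
  have := Real.sqrt_pos.2 ha
  field_simp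
  simp

lemma pi_withDensity {ι : Type*} [Fintype ι] (ν : Measure ℝ) [IsProbabilityMeasure ν]
    {g : ℝ → ℝ≥0∞} (hg : Measurable g) [SigmaFinite (ν.withDensity g)] :
    (Measure.pi fun _ : ι => ν.withDensity g)
      = (Measure.pi fun _ : ι => ν).withDensity fun x => ∏ i, g (x i) := by
  refine Measure.pi_eq fun s hs => ?_
  rw [withDensity_apply _ (MeasurableSet.univ_pi hs), ← lintegral_indicator
    (MeasurableSet.univ_pi hs)]
  have h : ∀ x : ι → ℝ, (Set.univ.pi s).indicator (fun x => ∏ i, g (x i)) x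
      = ∏ i, (s i).indicator g (x i) := by
    intro x
    by_cases hx : x ∈ Set.univ.pi s
    · rw [Set.indicator_of_mem hx]
      exact Finset.prod_congr rfl fun i _ => (Set.indicator_of_mem (hx i trivial) _).symm
    · rw [Set.indicator_of_notMem hx]
      simp only [Set.mem_pi, not_forall] at hx
      obtain ⟨i, -, hi⟩ := hx
      exact (Finset.prod_eq_zero (Finset.mem_univ i) (Set.indicator_of_notMem hi _)).symm
  simp_rw [h]
  have hm : ∀ i, Measurable ((s i).indicator g) := fun i => hg.indicator (hs i)
  have hind : iIndepFun (fun i (x : ι → ℝ) => (s i).indicator g (x i))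
      (Measure.pi fun _ : ι => ν) :=
    iIndepFun_pi (X := fun i => (s i).indicator g) fun i => (hm i).aemeasurable
  rw [lintegral_prod_eq_prod_lintegral_of_indepFun Finset.univ
    (fun i (x : ι → ℝ) => (s i).indicator g (x i)) hind
    fun i => (hm i).comp (measurable_pi_apply i)]
  refine Finset.prod_congr rfl fun i _ => ?_
  rw [withDensity_apply _ (hs i), ← lintegral_indicator (hs i)]
  exact (measurePreserving_eval (fun _ : ι => ν) i).lintegral_comp (hm i)

lemma stdNormal_map_smul (n : ℕ) (c : ℝ) : (stdNormal n).map (fun z => c • z)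
    = Measure.pi fun _ => gaussianReal 0 (c ^ 2).toNNReal := by
  have h := gaussianReal_map_const_mul (μ := 0) (v := 1) c
  have h' : (gaussianReal 0 1).map (fun x => c * x) = gaussianReal 0 (c ^ 2).toNNReal := by
    rw [h, mul_zero, mul_one]; congr 1; ext; simp [Real.coe_toNNReal _ (sq_nonneg c)]
  have := Measure.pi_map_pi (ι := Fin n) (μ := fun _ => gaussianReal 0 1) (f := fun _ x => c * x)
    (fun _ => by fun_prop)
  rw [h'] at this
  exact this

/-- Change of scale in a standard normal integral. -/
lemma lintegral_stdNormal_scale {n : ℕ} {a : ℝ} (ha : 0 < a) {f : (Fin n → ℝ) → ℝ≥0∞}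
    (hf : Measurable f) :
    ∫⁻ z, f ((√a)⁻¹ • z) ∂(stdNormal n) = ENNReal.ofReal (√a ^ n) *
      ∫⁻ z, ENNReal.ofReal (Real.exp ((1 - a) / 2 * sumSq z)) * f z ∂(stdNormal n) := by
  have h1 : ∫⁻ z, f ((√a)⁻¹ • z) ∂(stdNormal n)
      = ∫⁻ z, f z ∂((stdNormal n).map fun z => (√a)⁻¹ • z) :=
    (lintegral_map hf (by fun_prop)).symm
  have : SigmaFinite ((gaussianReal 0 1).withDensity
      (fun x => ENNReal.ofReal (√a * Real.exp ((1 - a) / 2 * x ^ 2)))) := by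
    rw [← gaussianReal_inv_eq_withDensity ha]; infer_instance
  rw [h1, stdNormal_map_smul, inv_pow, Real.sq_sqrt ha.le, gaussianReal_inv_eq_withDensity ha,
    pi_withDensity _ (by fun_prop), lintegral_withDensity_eq_lintegral_mul _ (by fun_prop) hf,
    ← lintegral_const_mul _ (by unfold sumSq; fun_prop)]
  congr 1
  ext z
  simp only [Pi.mul_apply]
  rw [← mul_assoc, ← ENNReal.ofReal_mul (by positivity),
    ← ENNReal.ofReal_prod_of_nonneg (fun i _ => by positivity)]
  congr 2
  rw [Finset.prod_mul_distrib, Finset.prod_const, ← Real.exp_sum, sumSq, Finset.mul_sum]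
  simp

/-- With all coordinates but the first fixed, at most two values of the first remain. For `n = 0`
there is an atom at `0`, whence `hn`. -/
lemma stdNormal_sumSq_eq {n : ℕ} (hn : n ≠ 0) (c : ℝ) : stdNormal n {z | sumSq z = c} = 0 := by
  obtain ⟨k, rfl⟩ := Nat.exists_eq_succ_of_ne_zero hn
  have hp := measurePreserving_piFinSuccAbove (fun _ : Fin (k + 1) => gaussianReal 0 1) 0
  have hS : MeasurableSet {p : ℝ × (Fin k → ℝ) | p.1 ^ 2 + sumSq p.2 = c} := by
    refine measurableSet_eq_fun ?_ measurable_const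
    exact (measurable_fst.pow_const 2).add (measurable_sumSq.comp measurable_snd)
  have h : {z : Fin (k + 1) → ℝ | sumSq z = c} = MeasurableEquiv.piFinSuccAbove (fun _ => ℝ) 0 ⁻¹'
      {p : ℝ × (Fin k → ℝ) | p.1 ^ 2 + sumSq p.2 = c} := by
    ext z
    simp [sumSq, Fin.sum_univ_succ, MeasurableEquiv.piFinSuccAbove, Fin.tail]
  rw [h, hp.measure_preimage hS.nullMeasurableSet,
    ← Measure.measurePreserving_swap.measure_preimage hS.nullMeasurableSet,
    Measure.measure_prod_null (measurable_swap hS)]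
  refine Eventually.of_forall fun y => ?_
  have hfin : {x : ℝ | x ^ 2 + sumSq y = c}.Finite := by
    refine (Set.toFinite {√(c - sumSq y), -√(c - sumSq y)}).subset fun x hx => ?_
    have hx' : c - sumSq y = x ^ 2 := by rw [← show x ^ 2 + sumSq y = c from hx]; ring
    rw [hx', Real.sqrt_sq_eq_abs]
    rcases abs_choice x with h | h <;> simp [h]
  have := nullSingletonClass_gaussianReal (μ := 0) (v := 1) one_ne_zero
  exact hfin.measure_zero _

/-! ### Independence of cones and the sum of squares -/

/-- The truncated integral of `exp (sumSq / 2)` over a set. -/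
def truncExpIntegral {n : ℕ} (A : Set (Fin n → ℝ)) (r : ℝ) : ℝ≥0∞ :=
  ∫⁻ z in A ∩ {z | sumSq z ≤ r}, ENNReal.ofReal (Real.exp (sumSq z / 2)) ∂(stdNormal n)

lemma measurableSet_sumSq_le {n : ℕ} (r : ℝ) : MeasurableSet {z : Fin n → ℝ | sumSq z ≤ r} :=
  measurableSet_le measurable_sumSq measurable_const

/-- The weight `exp (sumSq / 2)` cancels the Gaussian density and leaves a multiple of Lebesgue
measure, which is homogeneous on cones. -/
lemma truncExpIntegral_scale {n : ℕ} {A : Set (Fin n → ℝ)} (hA : MeasurableSet A)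
    (hcone : ∀ c : ℝ, 0 < c → ∀ z, c • z ∈ A ↔ z ∈ A) {a : ℝ} (ha : 0 < a) :
    truncExpIntegral A a = ENNReal.ofReal (√a ^ n) * truncExpIntegral A 1 := by
  have hm := hA.inter (measurableSet_sumSq_le (n := n) 1)
  have hmeas : Measurable (fun z : Fin n → ℝ => ENNReal.ofReal (Real.exp (a * sumSq z / 2))) := by
    unfold sumSq; fun_prop
  have hs := Real.sqrt_pos.2 ha
  have h := lintegral_stdNormal_scale ha (hmeas.indicator hm)
  rw [truncExpIntegral, truncExpIntegral, ← lintegral_indicator hm,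
    ← lintegral_indicator (hA.inter (measurableSet_sumSq_le a))]
  convert h using 2
  · ext z
    have hz : (√a)⁻¹ • z ∈ A ∩ {z | sumSq z ≤ 1} ↔ z ∈ A ∩ {z | sumSq z ≤ a} := by
      refine and_congr (hcone _ (by positivity) z) ?_
      simp only [Set.mem_ofPred_eq, sumSq_smul, inv_pow, Real.sq_sqrt ha.le]
      rw [inv_mul_le_iff₀ ha, mul_one]
    by_cases hz' : z ∈ A ∩ {z | sumSq z ≤ a}
    · rw [Set.indicator_of_mem hz', Set.indicator_of_mem (hz.2 hz'), sumSq_smul, inv_pow,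
        Real.sq_sqrt ha.le, mul_inv_cancel_left₀ ha.ne']
    · rw [Set.indicator_of_notMem hz', Set.indicator_of_notMem (fun h => hz' (hz.1 h))]
  · congr 1
    ext z
    by_cases hz' : z ∈ A ∩ {z | sumSq z ≤ 1}
    · rw [Set.indicator_of_mem hz', Set.indicator_of_mem hz', ← ENNReal.ofReal_mul (by positivity),
        ← Real.exp_add]
      congr 2; ring
    · simp [Set.indicator_of_notMem hz']

lemma truncExpIntegral_nonpos {n : ℕ} (hn : n ≠ 0) (A : Set (Fin n → ℝ)) {r : ℝ} (hr : r ≤ 0) :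
    truncExpIntegral A r = 0 := by
  refine setLIntegral_measure_zero _ _ (measure_mono_null ?_ (stdNormal_sumSq_eq hn 0))
  exact fun z hz => le_antisymm (le_trans hz.2 hr) (sumSq_nonneg z)

lemma truncExpIntegral_ne_top {n : ℕ} (A : Set (Fin n → ℝ)) (r : ℝ) :
    truncExpIntegral A r ≠ ∞ := by
  refine ne_top_of_le_ne_top (b := ENNReal.ofReal (Real.exp (r / 2))) ENNReal.ofReal_ne_top ?_
  calc truncExpIntegral A r
      ≤ ∫⁻ z in A ∩ {z | sumSq z ≤ r}, ENNReal.ofReal (Real.exp (r / 2)) ∂(stdNormal n) := by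
        refine setLIntegral_mono measurable_const fun z hz => ?_
        gcongr
        exact hz.2
    _ ≤ ENNReal.ofReal (Real.exp (r / 2)) := by
        rw [setLIntegral_const]
        exact mul_le_of_le_one_right' prob_le_one

/-- By homogeneity a cone occupies the same share of every ball; the ratio is cross-multiplied to
avoid division in `ℝ≥0∞`. -/
lemma truncExpIntegral_mul {n : ℕ} (hn : n ≠ 0) {A : Set (Fin n → ℝ)} (hA : MeasurableSet A)
    (hcone : ∀ c : ℝ, 0 < c → ∀ z, c • z ∈ A ↔ z ∈ A) (r : ℝ) :
    truncExpIntegral (n := n) Set.univ 1 * truncExpIntegral A r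
      = truncExpIntegral A 1 * truncExpIntegral (n := n) Set.univ r := by
  rcases le_or_gt r 0 with hr | hr
  · simp [truncExpIntegral_nonpos hn _ hr]
  · rw [truncExpIntegral_scale hA hcone hr,
      truncExpIntegral_scale MeasurableSet.univ (by simp) hr]
    ring

/-- Proportionality on every ball identifies two weighted laws of `sumSq`; integrating `exp (-x /
2)` against both removes the weight. The cap `R` keeps the weighted measures finite. -/
lemma truncExpIntegral_mul_stdNormal {n : ℕ} (hn : n ≠ 0) {A : Set (Fin n → ℝ)} (hA : MeasurableSet A)
    (hcone : ∀ c : ℝ, 0 < c → ∀ z, c • z ∈ A ↔ z ∈ A) (R : ℝ) :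
    truncExpIntegral (n := n) Set.univ 1 * stdNormal n (A ∩ {z | sumSq z ≤ R})
      = truncExpIntegral A 1 * stdNormal n {z | sumSq z ≤ R} := by
  set w : (Fin n → ℝ) → ℝ≥0∞ := fun z => ENNReal.ofReal (Real.exp (sumSq z / 2)) with hw
  have hwm : Measurable w := by simp only [hw]; unfold sumSq; fun_prop
  let ν : Set (Fin n → ℝ) → Measure ℝ := fun B =>
    (((stdNormal n).withDensity w).restrict (B ∩ {z | sumSq z ≤ R})).map sumSq
  have hν : ∀ B, MeasurableSet B → ∀ r, ν B (Set.Iic r) = truncExpIntegral B (min r R) := by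
    intro B hB r
    simp only [ν]
    rw [Measure.map_apply measurable_sumSq measurableSet_Iic,
      Measure.restrict_apply (measurable_sumSq measurableSet_Iic), withDensity_apply _
      ((measurable_sumSq measurableSet_Iic).inter (hB.inter (measurableSet_sumSq_le R))),
      truncExpIntegral]
    congr 2
    ext z
    simp only [Set.mem_inter_iff, Set.mem_preimage, Set.mem_Iic, Set.mem_ofPred_eq, le_min_iff]
    tauto
  have hνuniv : ∀ B, MeasurableSet B → ν B Set.univ = truncExpIntegral B R := by
    intro B hB
    simp only [ν]
    rw [Measure.map_apply measurable_sumSq MeasurableSet.univ, Set.preimage_univ,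
      Measure.restrict_apply_univ, withDensity_apply _ (hB.inter (measurableSet_sumSq_le R)),
      truncExpIntegral]
  have hfin : ∀ B, MeasurableSet B → IsFiniteMeasure (ν B) := fun B hB =>
    ⟨by rw [hνuniv B hB]; exact (truncExpIntegral_ne_top B R).lt_top⟩
  have := hfin A hA
  have := hfin Set.univ MeasurableSet.univ
  have hAtop := truncExpIntegral_ne_top A 1
  have hUtop := truncExpIntegral_ne_top (n := n) Set.univ 1
  have : IsFiniteMeasure (truncExpIntegral (n := n) Set.univ 1 • ν A) :=
    ⟨by rw [Measure.smul_apply]; exact ENNReal.mul_lt_top hUtop.lt_top (measure_lt_top _ _)⟩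
  have key : truncExpIntegral (n := n) Set.univ 1 • ν A = truncExpIntegral A 1 • ν Set.univ := by
    refine Measure.ext_of_Iic _ _ fun r => ?_
    simp only [Measure.smul_apply, smul_eq_mul]
    rw [hν A hA, hν _ MeasurableSet.univ, truncExpIntegral_mul hn hA hcone]
  have hint : ∀ B, MeasurableSet B → ∫⁻ x, ENNReal.ofReal (Real.exp (-x / 2)) ∂(ν B)
      = stdNormal n (B ∩ {z | sumSq z ≤ R}) := by
    intro B hB
    have hms := hB.inter (measurableSet_sumSq_le (n := n) R)
    simp only [ν]
    rw [lintegral_map (by fun_prop) measurable_sumSq, restrict_withDensity hms,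
      lintegral_withDensity_eq_lintegral_mul _ hwm
        (by have := measurable_sumSq (n := n); fun_prop)]
    have : ∀ z, (w * fun z : Fin n → ℝ => ENNReal.ofReal (Real.exp (-sumSq z / 2))) z = 1 := by
      intro z
      simp only [hw, Pi.mul_apply]
      rw [← ENNReal.ofReal_mul (by positivity), ← Real.exp_add]
      simp [neg_div]
    simp_rw [this]
    simp
  have := congrArg (fun m : Measure ℝ => ∫⁻ x, ENNReal.ofReal (Real.exp (-x / 2)) ∂m) key
  simp only [lintegral_smul_measure, smul_eq_mul] at this
  rw [hint A hA, hint _ MeasurableSet.univ, Set.univ_inter] at this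
  exact this

lemma truncExpIntegral_one_eq {n : ℕ} (hn : n ≠ 0) {A : Set (Fin n → ℝ)} (hA : MeasurableSet A)
    (hcone : ∀ c : ℝ, 0 < c → ∀ z, c • z ∈ A ↔ z ∈ A) :
    truncExpIntegral (n := n) Set.univ 1 * stdNormal n A = truncExpIntegral A 1 := by
  have hmono : Monotone fun k : ℕ => {z : Fin n → ℝ | sumSq z ≤ k} := fun i j hij z hz =>
    le_trans (show sumSq z ≤ i from hz) (by exact_mod_cast hij)
  have hU : ⋃ k : ℕ, {z : Fin n → ℝ | sumSq z ≤ k} = Set.univ :=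
    Set.eq_univ_of_forall fun z => Set.mem_iUnion.2 (exists_nat_ge (sumSq z))
  have h1 : Tendsto (fun k : ℕ => stdNormal n (A ∩ {z | sumSq z ≤ k})) atTop (𝓝 (stdNormal n A)) := by
    have := tendsto_measure_iUnion_atTop (μ := stdNormal n)
      (s := fun k : ℕ => A ∩ {z | sumSq z ≤ k}) (fun i j hij => Set.inter_subset_inter_right _ (hmono hij))
    rwa [← Set.inter_iUnion, hU, Set.inter_univ] at this
  have h2 : Tendsto (fun k : ℕ => stdNormal n {z | sumSq z ≤ k}) atTop (𝓝 1) := by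
    have := tendsto_measure_iUnion_atTop (μ := stdNormal n) hmono
    rwa [hU, measure_univ] at this
  have h3 := ENNReal.Tendsto.const_mul (a := truncExpIntegral (n := n) Set.univ 1) h1
    (Or.inr (truncExpIntegral_ne_top _ _))
  have h4 := ENNReal.Tendsto.const_mul (a := truncExpIntegral A 1) h2
    (Or.inr (truncExpIntegral_ne_top _ _))
  simp_rw [truncExpIntegral_mul_stdNormal hn hA hcone] at h3
  rw [mul_one] at h4
  exact tendsto_nhds_unique h3 h4

/-- Under the standard normal law, cones are independent of the sum of squares. -/
lemma stdNormal_cone_inter {n : ℕ} (hn : n ≠ 0) {A : Set (Fin n → ℝ)} (hA : MeasurableSet A)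
    (hcone : ∀ c : ℝ, 0 < c → ∀ z, c • z ∈ A ↔ z ∈ A) (c : ℝ) :
    stdNormal n (A ∩ {z | c < sumSq z}) = stdNormal n A * stdNormal n {z | c < sumSq z} := by
  set t := truncExpIntegral (n := n) Set.univ 1 with ht
  -- Needed to cancel `t` below: if it vanished, homogeneity would make every ball null.
  have ht0 : t ≠ 0 := by
    intro h0
    have hz : ∀ k : ℕ, stdNormal n {z | sumSq z ≤ k} = 0 := by
      intro k
      refine measure_mono_null (t := Set.univ ∩ {z | sumSq z ≤ k}) (by simp) (le_antisymm ?_ bot_le)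
      calc stdNormal n (Set.univ ∩ {z | sumSq z ≤ k})
          ≤ truncExpIntegral (n := n) Set.univ k := by
            rw [truncExpIntegral, ← setLIntegral_one]
            refine lintegral_mono fun z => ?_
            rw [← ENNReal.ofReal_one]
            exact ENNReal.ofReal_le_ofReal (Real.one_le_exp (by linarith [sumSq_nonneg z]))
        _ = 0 := by
            rcases le_or_gt (k : ℝ) 0 with hk | hk
            · exact truncExpIntegral_nonpos hn _ hk
            · rw [truncExpIntegral_scale MeasurableSet.univ (by simp) hk, ← ht, h0, mul_zero]
    have h1 : stdNormal n Set.univ = 0 := by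
      rw [← Set.eq_univ_of_forall fun z : Fin n → ℝ =>
        Set.mem_iUnion.2 (exists_nat_ge (sumSq z))]
      exact measure_iUnion_null hz
    simp at h1
  have hle : stdNormal n (A ∩ {z | sumSq z ≤ c}) = stdNormal n A * stdNormal n {z | sumSq z ≤ c} := by
    have h := truncExpIntegral_mul_stdNormal hn hA hcone c
    rw [← truncExpIntegral_one_eq hn hA hcone, mul_assoc] at h
    exact (ENNReal.mul_right_inj ht0 (truncExpIntegral_ne_top _ _)).1 h
  have hc : {z : Fin n → ℝ | c < sumSq z} = {z | sumSq z ≤ c}ᶜ := by ext; simp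
  rw [hc, prob_compl_eq_one_sub (measurableSet_sumSq_le c), ENNReal.mul_sub (by simp), mul_one, ← hle,
    ← Set.sdiff_eq, ← Set.sdiff_self_inter, measure_sdiff Set.inter_subset_left
    (hA.inter (measurableSet_sumSq_le c)).nullMeasurableSet (measure_ne_top _ _)]

/-! ### Tail of the sum of squares under a perturbed threshold -/

/-- The exponential moment of the sum of squares, restricted to its exceeding `u`. -/
def tailExpMoment (n : ℕ) (u t : ℝ) : ℝ≥0∞ :=
  ∫⁻ z in {z | u < sumSq z}, ENNReal.ofReal (Real.exp (t * sumSq z)) ∂(stdNormal n)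

lemma measurableSet_lt_sumSq {n : ℕ} (u : ℝ) : MeasurableSet {z : Fin n → ℝ | u < sumSq z} :=
  measurableSet_lt measurable_const measurable_sumSq

lemma tailExpMoment_zero (n : ℕ) (u : ℝ) :
    tailExpMoment n u 0 = stdNormal n {z | u < sumSq z} := by
  simp [tailExpMoment]

/-- A change of threshold is traded for an exponential tilt at a fixed threshold, so that convexity
in the tilt becomes available. -/
lemma stdNormal_tail_scale {n : ℕ} {a : ℝ} (ha : 0 < a) (u : ℝ) :
    stdNormal n {z | a * u < sumSq z}
      = ENNReal.ofReal (√a ^ n) * tailExpMoment n u ((1 - a) / 2) := by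
  have h := lintegral_stdNormal_scale ha (n := n)
    ((measurable_const (a := (1 : ℝ≥0∞))).indicator (measurableSet_lt_sumSq u))
  rw [tailExpMoment, ← lintegral_indicator (measurableSet_lt_sumSq u)]
  convert h using 2
  · rw [← lintegral_indicator_one (measurableSet_lt_sumSq _)]
    congr 1
    ext z
    simp only [Set.indicator_apply, Set.mem_ofPred_eq, sumSq_smul, inv_pow, Real.sq_sqrt ha.le,
      lt_inv_mul_iff₀ ha, Pi.one_apply]
  · congr 1
    ext z
    simp only [Set.indicator_apply]
    split_ifs <;> simp

lemma tailExpMoment_le {n : ℕ} {a : ℝ} (ha : 0 < a) (u : ℝ) :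
    tailExpMoment n u ((1 - a) / 2) ≤ ENNReal.ofReal ((√a ^ n)⁻¹) := by
  have hs := Real.sqrt_pos.2 ha
  rw [ENNReal.ofReal_inv_of_pos (by positivity), ← one_div, ENNReal.le_div_iff_mul_le (by simp [hs])
    (by simp), mul_comm, ← stdNormal_tail_scale ha]
  exact prob_le_one

/-- Log-convexity of exponential moments. -/
lemma tailExpMoment_convex (n : ℕ) (u s t : ℝ) {p q : ℝ} (hp : 0 ≤ p) (hq : 0 ≤ q)
    (hpq : p + q = 1) :
    tailExpMoment n u (p * s + q * t) ≤ tailExpMoment n u s ^ p * tailExpMoment n u t ^ q := by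
  have hm : ∀ t, Measurable fun z : Fin n → ℝ => ENNReal.ofReal (Real.exp (t * sumSq z)) := by
    intro t; unfold sumSq; fun_prop
  refine le_trans (le_of_eq ?_) (ENNReal.lintegral_mul_norm_pow_le (hm s).aemeasurable
    (hm t).aemeasurable hp hq hpq)
  refine lintegral_congr fun z => ?_
  rw [ENNReal.ofReal_rpow_of_pos (Real.exp_pos _), ENNReal.ofReal_rpow_of_pos (Real.exp_pos _),
    ← ENNReal.ofReal_mul (by positivity), ← Real.exp_mul, ← Real.exp_mul, ← Real.exp_add]
  congr 2; ring

lemma neg_log_one_sub_le {x : ℝ} (hx : x ≤ 1 / 2) :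
    -Real.log (1 - x) ≤ x + 2 * x ^ 2 := by
  have h := Real.one_sub_inv_le_log_of_pos (show 0 < 1 - x by linarith)
  have : (1 - x)⁻¹ ≤ 1 + x + 2 * x ^ 2 := by
    rw [inv_le_iff_one_le_mul₀ (by linarith)]
    nlinarith [mul_nonneg (sq_nonneg x) (show 0 ≤ 1 - 2 * x by linarith)]
  linarith

lemma sqrt_pow_eq_exp {a : ℝ} (ha : 0 < a) (n : ℕ) : √a ^ n = Real.exp (n / 2 * Real.log a) := by
  rw [← Real.exp_log (Real.sqrt_pos.2 ha), ← Real.exp_nat_mul, Real.log_sqrt ha.le]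
  congr 1; ring

/-- Shrinking a threshold by a factor `1 - ρ / √n` changes the tail probability little. -/
lemma stdNormal_tail_shrink_le {n : ℕ} (hn : 2 ≤ n) {u ρ q : ℝ} (hρ0 : 0 ≤ ρ) (hρ : ρ ≤ 1 / 2)
    (hq : 0 < q) (hq1 : stdNormal n {z | u < sumSq z} = ENNReal.ofReal q) :
    stdNormal n {z | (1 - ρ / √n) * u < sumSq z}
      ≤ ENNReal.ofReal (q * Real.exp (2 * ρ * -Real.log q + ρ / 2)) := by
  have hn' : (2 : ℝ) ≤ n := by exact_mod_cast hn
  have hsn : 1 < √(n : ℝ) := by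
    rw [Real.lt_sqrt (by norm_num)]; linarith
  have hsn2 : √(n : ℝ) * √(n : ℝ) = n := Real.mul_self_sqrt (by linarith)
  set δ := ρ / √(n : ℝ) with hδ
  -- Reference tilt for the interpolation, small enough that `n * η ^ 2` is bounded; `δ / 2` lies
  -- the fraction `2 * ρ` of the way from `0` to `η / 2`.
  set η := 1 / (2 * √(n : ℝ)) with hη
  have hη0 : 0 < η := by positivity
  have hη1 : η ≤ 1 / 2 := by
    rw [hη]; gcongr; linarith
  have hδη : δ = (2 * ρ) * η := by rw [hδ, hη]; field_simp
  have hδ1 : δ ≤ 1 / 2 := by rw [hδη]; nlinarith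
  have hδ0 : 0 ≤ δ := by positivity
  have h1 := tailExpMoment_convex n u 0 ((1 - (1 - η)) / 2) (p := 1 - 2 * ρ) (q := 2 * ρ)
    (by linarith) (by linarith) (by ring)
  have e1 : (1 - 2 * ρ) * 0 + 2 * ρ * ((1 - (1 - η)) / 2) = (1 - (1 - δ)) / 2 := by
    rw [hδη]; ring
  rw [e1, tailExpMoment_zero, hq1] at h1
  have h2 := tailExpMoment_le (n := n) (show 0 < 1 - η by linarith) u
  have h3 : tailExpMoment n u ((1 - (1 - δ)) / 2) ≤
      ENNReal.ofReal q ^ (1 - 2 * ρ) * ENNReal.ofReal ((√(1 - η) ^ n)⁻¹) ^ (2 * ρ) :=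
    h1.trans (by gcongr)
  have hpos : 0 < (√(1 - η) ^ n)⁻¹ := by
    have := Real.sqrt_pos.2 (show 0 < 1 - η by linarith)
    positivity
  rw [ENNReal.ofReal_rpow_of_pos hq, ENNReal.ofReal_rpow_of_pos hpos,
    ← ENNReal.ofReal_mul (by positivity)] at h3
  rw [stdNormal_tail_scale (by linarith)]
  refine (mul_le_mul_right h3 _).trans ?_
  rw [← ENNReal.ofReal_mul (by positivity)]
  refine ENNReal.ofReal_le_ofReal ?_
  rw [sqrt_pow_eq_exp (by linarith), sqrt_pow_eq_exp (by linarith), ← Real.exp_neg,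
    ← Real.exp_mul, Real.rpow_def_of_pos hq, ← Real.exp_add, ← Real.exp_add]
  nth_rewrite 2 [← Real.exp_log hq]
  rw [← Real.exp_add]
  refine Real.exp_le_exp.2 ?_
  have l1 := Real.log_le_sub_one_of_pos (show 0 < 1 - δ by linarith)
  have l2 := neg_log_one_sub_le hη1
  have m1 : (n : ℝ) / 2 * Real.log (1 - δ) ≤ n / 2 * (-δ) := by gcongr; linarith
  have m2 : (2 * ρ) * (n / 2) * -Real.log (1 - η) ≤ (2 * ρ) * (n / 2) * (η + 2 * η ^ 2) := by
    gcongr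
  -- Since `δ = 2 * ρ * η`, the terms linear in `η` cancel and only the quadratic one survives.
  have m3 : n / 2 * (-δ) + (2 * ρ) * (n / 2) * (η + 2 * η ^ 2) = ρ / 2 := by
    have : (n : ℝ) * η ^ 2 = 1 / 4 := by
      rw [hη, div_pow, mul_pow, Real.sq_sqrt (by linarith)]; field_simp; norm_num
    rw [hδη]
    linear_combination (2 * ρ) * this
  linarith

/-- Enlarging a threshold by a factor `1 + ρ / √n` changes the tail probability little. -/
lemma le_stdNormal_tail_enlarge {n : ℕ} (hn : 2 ≤ n) {u ρ q : ℝ} (hρ0 : 0 ≤ ρ) (hρ : ρ ≤ 1 / 2)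
    (hq : 0 < q) (hq1 : stdNormal n {z | u < sumSq z} = ENNReal.ofReal q) :
    ENNReal.ofReal (q * Real.exp (-(2 * ρ * -Real.log q + ρ / 2) - ρ ^ 2))
      ≤ stdNormal n {z | (1 + ρ / √n) * u < sumSq z} := by
  have hn' : (2 : ℝ) ≤ n := by exact_mod_cast hn
  have hsn : 1 < √(n : ℝ) := by
    rw [Real.lt_sqrt (by norm_num)]; linarith
  have hsn2 : √(n : ℝ) * √(n : ℝ) = n := Real.mul_self_sqrt (by linarith)
  have hup := stdNormal_tail_shrink_le hn hρ0 hρ hq hq1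
  set δ := ρ / √(n : ℝ) with hδ
  set b := 2 * ρ * -Real.log q + ρ / 2 with hb
  have hδ0 : 0 ≤ δ := by positivity
  have hδρ : δ ≤ ρ := div_le_self hρ0 hsn.le
  have hδn : (n : ℝ) * δ ^ 2 = ρ ^ 2 := by
    rw [hδ, div_pow, Real.sq_sqrt (by linarith)]; field_simp
  -- Zero tilt is the midpoint of the tilts for `1 - δ` and `1 + δ`, so log-convexity turns the
  -- upper bound at `1 - δ` into a lower bound at `1 + δ`.
  have hc := tailExpMoment_convex n u ((1 - (1 - δ)) / 2) ((1 - (1 + δ)) / 2) (p := 1 / 2)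
    (q := 1 / 2) (by norm_num) (by norm_num) (by norm_num)
  have e1 : 1 / 2 * ((1 - (1 - δ)) / 2) + 1 / 2 * ((1 - (1 + δ)) / 2) = 0 := by ring
  rw [e1, tailExpMoment_zero, hq1, ← ENNReal.mul_rpow_of_nonneg _ _ (by norm_num)] at hc
  have hc2 : ENNReal.ofReal (q ^ 2) ≤ tailExpMoment n u ((1 - (1 - δ)) / 2) *
      tailExpMoment n u ((1 - (1 + δ)) / 2) := by
    have := ENNReal.rpow_le_rpow hc (show (0 : ℝ) ≤ 2 by norm_num)
    rw [← ENNReal.rpow_mul, ENNReal.ofReal_rpow_of_pos hq] at this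
    norm_num at this
    convert this using 3 <;> ring
  have sl := stdNormal_tail_scale (n := n) (show 0 < 1 - δ by linarith) u
  have sr := stdNormal_tail_scale (n := n) (show 0 < 1 + δ by linarith) u
  set Gl := stdNormal n {z | (1 - δ) * u < sumSq z}
  set Gr := stdNormal n {z | (1 + δ) * u < sumSq z}
  have key : ENNReal.ofReal (√(1 - δ) ^ n * √(1 + δ) ^ n * q ^ 2)
      ≤ ENNReal.ofReal (q * Real.exp b) * Gr := by
    calc ENNReal.ofReal (√(1 - δ) ^ n * √(1 + δ) ^ n * q ^ 2)
        = ENNReal.ofReal (√(1 - δ) ^ n) * ENNReal.ofReal (√(1 + δ) ^ n) * ENNReal.ofReal (q ^ 2) := by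
          rw [ENNReal.ofReal_mul (by positivity), ENNReal.ofReal_mul (by positivity)]
      _ ≤ ENNReal.ofReal (√(1 - δ) ^ n) * ENNReal.ofReal (√(1 + δ) ^ n) *
          (tailExpMoment n u ((1 - (1 - δ)) / 2) * tailExpMoment n u ((1 - (1 + δ)) / 2)) := by
          gcongr
      _ = Gl * Gr := by rw [sl, sr]; ring
      _ ≤ _ := by gcongr
  have hGr : Gr ≠ ∞ := measure_ne_top _ _
  rw [← ENNReal.ofReal_toReal hGr, ← ENNReal.ofReal_mul (by positivity),
    ENNReal.ofReal_le_ofReal_iff (by positivity)] at key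
  rw [← ENNReal.ofReal_toReal hGr]
  refine ENNReal.ofReal_le_ofReal ?_
  -- The prefactors multiply to `(1 - δ ^ 2) ^ (n / 2)`; as `n * δ ^ 2 = ρ ^ 2`, this is the source
  -- of the extra loss `ρ ^ 2`.
  have hl : Real.exp (-ρ ^ 2) ≤ √(1 - δ) ^ n * √(1 + δ) ^ n := by
    rw [← mul_pow, ← Real.sqrt_mul (by linarith), sqrt_pow_eq_exp (by nlinarith)]
    refine Real.exp_le_exp.2 ?_
    have hδ2 : δ ^ 2 ≤ 1 / 4 := by nlinarith
    have := neg_log_one_sub_le (x := δ ^ 2) (by linarith)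
    have e : (1 - δ) * (1 + δ) = 1 - δ ^ 2 := by ring
    rw [e]
    have h2 : -Real.log (1 - δ ^ 2) ≤ 2 * δ ^ 2 := by nlinarith [sq_nonneg δ]
    have h3 : (n : ℝ) / 2 * -Real.log (1 - δ ^ 2) ≤ n / 2 * (2 * δ ^ 2) := by gcongr
    linarith
  have hfin : Real.exp (-ρ ^ 2) * q ^ 2 ≤ q * Real.exp b * Gr.toReal :=
    (mul_le_mul_of_nonneg_right hl (sq_nonneg q)).trans key
  have e2 : Real.exp (-b - ρ ^ 2) = Real.exp (-ρ ^ 2) * (Real.exp b)⁻¹ := by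
    rw [← Real.exp_neg, ← Real.exp_add]; congr 1; ring
  rw [e2, ← mul_assoc, ← div_eq_mul_inv, div_le_iff₀ (Real.exp_pos b)]
  refine le_of_mul_le_mul_left ?_ hq
  linarith

/-! ### Quantiles of a law on the line -/

section Quantile

variable {ν : Measure ℝ}

lemma bddBelow_le_cdf {p : ℝ} (hp : 0 < p) : BddBelow {x : ℝ | p ≤ cdf ν x} := by
  obtain ⟨b, hb⟩ := ((tendsto_cdf_atBot ν).eventually (gt_mem_nhds hp)).exists
  refine ⟨b, fun x hx => le_of_not_gt fun h => ?_⟩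
  exact absurd (monotone_cdf ν h.le) (not_le.2 (hb.trans_le hx))

lemma nonempty_le_cdf {p : ℝ} (hp : p < 1) : {x : ℝ | p ≤ cdf ν x}.Nonempty := by
  obtain ⟨b, hb⟩ := ((tendsto_cdf_atTop ν).eventually (lt_mem_nhds hp)).exists
  exact ⟨b, hb.le⟩

lemma le_cdf_quantile {p : ℝ} (hp1 : p < 1) : p ≤ cdf ν (quantile ν p) := by
  have h : Tendsto (cdf ν) (𝓝[>] (quantile ν p)) (𝓝 (cdf ν (quantile ν p))) :=
    ((cdf ν).right_continuous _).tendsto.mono_left (nhdsWithin_mono _ Set.Ioi_subset_Ici_self)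
  refine ge_of_tendsto h ?_
  filter_upwards [self_mem_nhdsWithin] with y hy
  obtain ⟨x, hx, hxy⟩ := exists_lt_of_csInf_lt (nonempty_le_cdf hp1) hy
  exact le_trans hx (monotone_cdf ν hxy.le)

lemma cdf_lt_of_lt_quantile {p y : ℝ} (hp : 0 < p) (hy : y < quantile ν p) : cdf ν y < p :=
  lt_of_not_ge fun h => not_le.2 hy (csInf_le (bddBelow_le_cdf hp) h)

lemma quantile_mono {p p' : ℝ} (hp : 0 < p) (hpp : p ≤ p') (hp' : p' < 1) :
    quantile ν p ≤ quantile ν p' :=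
  csInf_le_csInf (bddBelow_le_cdf hp) (nonempty_le_cdf hp') fun _ hx => le_trans hpp hx

lemma measure_quantile_lt_le [IsProbabilityMeasure ν] {p : ℝ} (hp : p < 1) :
    ν {x | quantile ν p < x} ≤ ENNReal.ofReal (1 - p) := by
  have h : {x | quantile ν p < x} = (Set.Iic (quantile ν p))ᶜ := by ext; simp
  rw [h, prob_compl_eq_one_sub measurableSet_Iic, ← ofReal_cdf ν, ← ENNReal.ofReal_one,
    ← ENNReal.ofReal_sub _ (cdf_nonneg ν _)]
  exact ENNReal.ofReal_le_ofReal (by linarith [le_cdf_quantile (ν := ν) hp])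

lemma measure_quantile_lt_abs_le [IsProbabilityMeasure ν] (hν : ν.map (fun x => -x) = ν) {β : ℝ}
    (hβ : 0 < β) : ν {x | quantile ν (1 - β / 2) < |x|} ≤ ENNReal.ofReal β := by
  set t := quantile ν (1 - β / 2)
  have h1 : ν {x | t < x} ≤ ENNReal.ofReal (β / 2) := by
    simpa using measure_quantile_lt_le (ν := ν) (show 1 - β / 2 < 1 by linarith)
  have h2 : ν {x | t < -x} = ν {x | t < x} := by
    conv_rhs => rw [← hν]
    exact (Measure.map_apply measurable_neg measurableSet_Ioi).symm
  calc ν {x | t < |x|} ≤ ν ({x | t < x} ∪ {x | t < -x}) :=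
        measure_mono fun x (hx : t < |x|) => show t < x ∨ t < -x from lt_abs.1 hx
    _ ≤ ν {x | t < x} + ν {x | t < -x} := measure_union_le _ _
    _ ≤ ENNReal.ofReal (β / 2) + ENNReal.ofReal (β / 2) := by rw [h2]; gcongr
    _ = ENNReal.ofReal β := by rw [← ENNReal.ofReal_add (by linarith) (by linarith)]; simp

end Quantile

/-! ### Chi-squared quantiles -/

lemma chiSquared_eq_map (n : ℕ) : chiSquared n = (stdNormal n).map sumSq := rfl

instance (n : ℕ) : IsProbabilityMeasure (chiSquared n) := by
  rw [chiSquared_eq_map]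
  exact Measure.isProbabilityMeasure_map measurable_sumSq.aemeasurable

instance (n : ℕ) : IsProbabilityMeasure (studentT n) :=
  Measure.isProbabilityMeasure_map (by fun_prop)

lemma cdf_chiSquared (n : ℕ) (x : ℝ) :
    ENNReal.ofReal (cdf (chiSquared n) x) = stdNormal n {z | sumSq z ≤ x} := by
  rw [ofReal_cdf, chiSquared_eq_map, Measure.map_apply measurable_sumSq measurableSet_Iic]
  rfl

lemma cdf_chiSquared_of_nonpos {n : ℕ} (hn : n ≠ 0) {x : ℝ} (hx : x ≤ 0) :
    cdf (chiSquared n) x = 0 := by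
  refine le_antisymm ?_ (cdf_nonneg _ _)
  rw [← ENNReal.ofReal_eq_zero, cdf_chiSquared]
  refine measure_mono_null ?_ (stdNormal_sumSq_eq hn 0)
  exact fun z hz => le_antisymm (le_trans hz hx) (sumSq_nonneg z)

lemma quantile_zero (ν : Measure ℝ) : quantile ν 0 = 0 := by
  simp [quantile, cdf_nonneg]

lemma quantile_chiSquared_nonneg {n : ℕ} (hn : n ≠ 0) {p : ℝ} (hp0 : 0 ≤ p) :
    0 ≤ quantile (chiSquared n) p := by
  rcases hp0.eq_or_lt with rfl | hp
  · rw [quantile_zero]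
  · refine Real.sInf_nonneg fun x hx => le_of_not_gt fun h => ?_
    have : p ≤ cdf (chiSquared n) x := hx
    rw [cdf_chiSquared_of_nonpos hn h.le] at this
    linarith

/-- Absence of atoms rules out a jump at the quantile. The order `p = 0` (the case `γ = 1`) is
separate: the default value `0` of `sInf` is a point where the distribution function vanishes. -/
lemma cdf_chiSquared_quantile {n : ℕ} (hn : n ≠ 0) {p : ℝ} (hp0 : 0 ≤ p) (hp1 : p < 1) :
    cdf (chiSquared n) (quantile (chiSquared n) p) = p := by
  rcases hp0.eq_or_lt with rfl | hp
  · rw [quantile_zero, cdf_chiSquared_of_nonpos hn le_rfl]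
  refine le_antisymm ?_ (le_cdf_quantile hp1)
  set u := quantile (chiSquared n) p with hu
  have hat : chiSquared n {u} = 0 := by
    rw [chiSquared_eq_map, Measure.map_apply measurable_sumSq (measurableSet_singleton _)]
    exact stdNormal_sumSq_eq hn u
  have hio : chiSquared n (Set.Iio u) ≤ ENNReal.ofReal p := by
    obtain ⟨s, hs, hlt, hlim⟩ := exists_seq_strictMono_tendsto u
    have hU : Set.Iio u = ⋃ k, Set.Iic (s k) := by
      ext x
      simp only [Set.mem_Iio, Set.mem_iUnion, Set.mem_Iic]
      refine ⟨fun hx => ?_, fun ⟨k, hk⟩ => hk.trans_lt (hlt k)⟩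
      obtain ⟨k, hk⟩ := (hlim.eventually (lt_mem_nhds hx)).exists
      exact ⟨k, hk.le⟩
    have hmono : Monotone fun k => Set.Iic (s k) := fun i j hij =>
      Set.Iic_subset_Iic.2 (hs.monotone hij)
    rw [hU, hmono.measure_iUnion]
    refine iSup_le fun k => ?_
    rw [← ofReal_cdf]
    exact ENNReal.ofReal_le_ofReal (cdf_lt_of_lt_quantile hp (hlt k)).le
  rw [← ENNReal.ofReal_le_ofReal_iff hp0, ofReal_cdf, ← Set.Iio_union_right]
  exact (measure_union_le _ _).trans (by rw [hat, add_zero]; exact hio)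

lemma stdNormal_quantile_lt {n : ℕ} (hn : n ≠ 0) {p : ℝ} (hp0 : 0 ≤ p) (hp1 : p < 1) :
    stdNormal n {z | quantile (chiSquared n) p < sumSq z} = ENNReal.ofReal (1 - p) := by
  have hc : {z : Fin n → ℝ | quantile (chiSquared n) p < sumSq z}
      = {z | sumSq z ≤ quantile (chiSquared n) p}ᶜ := by ext; simp
  rw [hc, prob_compl_eq_one_sub (measurableSet_sumSq_le _), ← cdf_chiSquared,
    cdf_chiSquared_quantile hn hp0 hp1, ← ENNReal.ofReal_one, ← ENNReal.ofReal_sub _ hp0]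

/-! ### Null law of the t-statistic -/

lemma studentT_map_neg (k : ℕ) : (studentT k).map (fun x => -x) = studentT k := by
  have hg : (gaussianReal 0 1).map (fun x => -x) = gaussianReal 0 1 := by
    rw [gaussianReal_map_neg, neg_zero]
  have h : (gaussianReal 0 1).prod (chiSquared k)
      = ((gaussianReal 0 1).prod (chiSquared k)).map (Prod.map (fun x => -x) id) := by
    rw [← Measure.map_prod_map _ _ measurable_neg measurable_id, hg, Measure.map_id]
  rw [studentT, Measure.map_map measurable_neg (by fun_prop)]
  conv_rhs => rw [h, Measure.map_map (by fun_prop) (by fun_prop)]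
  congr 1
  ext p
  simp [neg_div]

lemma sampleVar_eq {n : ℕ} (hn : n ≠ 0) (x : Fin n → ℝ) :
    sampleVar x = (sumSq x - (√n * sampleMean x) ^ 2) / ((n : ℝ) - 1) := by
  have hn' : (n : ℝ) ≠ 0 := by exact_mod_cast hn
  rw [sampleVar]
  congr 1
  have : ∑ j, x j = n * sampleMean x := by rw [sampleMean]; field_simp
  simp only [sub_sq, Finset.sum_add_distrib, Finset.sum_sub_distrib, ← Finset.sum_mul,
    ← Finset.mul_sum, this]
  rw [mul_pow, Real.sq_sqrt (Nat.cast_nonneg n), sumSq]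
  simp
  ring

lemma exists_orthonormalBasis_const (k : ℕ) :
    ∃ b : OrthonormalBasis (Fin (k + 1)) ℝ (EuclideanSpace ℝ (Fin (k + 1))),
      b 0 = WithLp.toLp 2 fun _ => (√((k + 1 : ℕ) : ℝ))⁻¹ := by
  set e : EuclideanSpace ℝ (Fin (k + 1)) := WithLp.toLp 2 fun _ => (√((k + 1 : ℕ) : ℝ))⁻¹ with he
  have hpos : (0 : ℝ) < ((k + 1 : ℕ) : ℝ) := by positivity
  have hnorm : ‖e‖ = 1 := by
    rw [EuclideanSpace.norm_eq, Real.sqrt_eq_one]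
    simp only [he, Real.norm_eq_abs, sq_abs, inv_pow, Real.sq_sqrt hpos.le]
    simp
    field_simp
  have hv : Orthonormal ℝ (({0} : Set (Fin (k + 1))).domRestrict fun _ => e) := by
    refine ⟨fun _ => hnorm, fun i j hij => ?_⟩
    exact absurd (Subsingleton.elim i j) hij
  obtain ⟨b, hb⟩ := hv.exists_orthonormalBasis_extension_of_card_eq
    (by simp [finrank_euclideanSpace])
  exact ⟨b, hb 0 rfl⟩

/-- Gosset's theorem: the t-statistic of a standard normal sample of size `k + 1` follows
Student's t-distribution with `k` degrees of freedom. -/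
lemma stdNormal_map_tStat (k : ℕ) : (stdNormal (k + 1)).map tStat = studentT k := by
  obtain ⟨b, hb⟩ := exists_orthonormalBasis_const k
  have hpos : (0 : ℝ) < ((k + 1 : ℕ) : ℝ) := by positivity
  -- A rotation: it preserves the normal law and `sumSq`, and turns `√n` times the mean into
  -- coordinate `0`, so the residual sum of squares is that of the other `k` coordinates.
  let y : (Fin (k + 1) → ℝ) → EuclideanSpace ℝ (Fin (k + 1)) := fun x => ∑ i, x i • b i
  have hrot : (stdNormal (k + 1)).map (WithLp.toLp 2) = (stdNormal (k + 1)).map y := by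
    rw [map_pi_eq_stdGaussian, stdGaussian_eq_map_pi_orthonormalBasis b]
  have hmean : ∀ x, √((k + 1 : ℕ) : ℝ) * sampleMean (WithLp.ofLp (y x)) = x 0 := by
    intro x
    have h1 : inner ℝ (b 0) (y x) = x 0 := by
      simpa using b.orthonormal.inner_right_fintype x 0
    rw [← h1, hb, PiLp.inner_apply, sampleMean]
    simp only [RCLike.inner_apply, conj_trivial, ← Finset.sum_mul]
    rw [← Real.sqrt_div_self]
    ring
  have hsum : ∀ x, sumSq (WithLp.ofLp (y x)) = sumSq x := by
    intro x
    have h1 := b.sum_sq_norm_inner_right (y x)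
    simp only [y, b.orthonormal.inner_right_fintype, Real.norm_eq_abs, sq_abs] at h1
    rw [EuclideanSpace.real_norm_sq_eq] at h1
    exact h1.symm
  have hfun : ∀ x, tStat (WithLp.ofLp (y x)) = x 0 / √((∑ i : Fin k, x i.succ ^ 2) / k) := by
    intro x
    rw [tStat, sampleVar_eq (Nat.succ_ne_zero k), hmean, hsum, sumSq, Fin.sum_univ_succ]
    simp
  have hm : Measurable fun v : EuclideanSpace ℝ (Fin (k + 1)) => tStat (WithLp.ofLp v) :=
    measurable_tStat.comp (by fun_prop)
  have hp := measurePreserving_piFinSuccAbove (fun _ : Fin (k + 1) => gaussianReal 0 1) 0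
  have h1 : (stdNormal (k + 1)).map tStat
      = (stdNormal (k + 1)).map fun x => x 0 / √((∑ i : Fin k, x i.succ ^ 2) / k) := by
    calc (stdNormal (k + 1)).map tStat
        = ((stdNormal (k + 1)).map (WithLp.toLp 2)).map fun v => tStat (WithLp.ofLp v) := by
          rw [Measure.map_map hm (by fun_prop)]; rfl
      _ = _ := by
          rw [hrot, Measure.map_map hm (by fun_prop)]
          congr 1
          ext x
          exact hfun x
  have h2 : (gaussianReal 0 1).prod (chiSquared k)
      = ((gaussianReal 0 1).prod (stdNormal k)).map (Prod.map id sumSq) := by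
    rw [← Measure.map_prod_map _ _ measurable_id measurable_sumSq, Measure.map_id]; rfl
  have hpr : Measurable (Prod.map id sumSq : ℝ × (Fin k → ℝ) → ℝ × ℝ) :=
    measurable_id.prodMap measurable_sumSq
  rw [h1, studentT, h2, Measure.map_map (by fun_prop) hpr, ← hp.map_eq,
    Measure.map_map (Measurable.comp (by fun_prop) hpr) hp.measurable]
  congr 1

/-- The size of the two-sided t-test for a standard normal sample. -/
lemma stdNormal_tStat_le {n : ℕ} (hn : 2 ≤ n) {β : ℝ} (hβ : 0 < β) :
    stdNormal n {z | quantile (studentT (n - 1)) (1 - β / 2) < |tStat z|} ≤ ENNReal.ofReal β := by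
  obtain ⟨k, rfl⟩ : ∃ k, n = k + 1 := ⟨n - 1, by omega⟩
  rw [Nat.add_sub_cancel]
  refine le_trans (le_of_eq ?_) (measure_quantile_lt_abs_le (studentT_map_neg k) hβ)
  have hms : MeasurableSet {x : ℝ | quantile (studentT k) (1 - β / 2) < |x|} :=
    measurableSet_lt measurable_const (by fun_prop)
  rw [← stdNormal_map_tStat, Measure.map_apply measurable_tStat (by rwa [stdNormal_map_tStat]),
    stdNormal_map_tStat]
  rfl

/-! ### Finite-sample bounds under arbitrary dependence -/

section FiniteSample

variable {Ω : Type*} [MeasurableSpace Ω] {P : Measure Ω} {m n : ℕ}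
  {X : Fin m → Fin n → Ω → ℝ} {μ : Fin m → ℝ} {σ : ℝ}

/-- Independence of the vectors over `j` passes to each coordinate, whatever the dependence within a
vector. -/
lemma IsSample.map_row (hX : IsSample P X μ σ) {i : Fin m} (hi : μ i = 0) :
    P.map (fun ω j => X i j ω) = (stdNormal n).map fun z => σ • z := by
  have hind : iIndepFun (fun j => X i j) P :=
    hX.indep.comp (fun _ (v : Fin m → ℝ) => v i) fun _ => measurable_pi_apply i
  rw [hind.map_fun_eq_pi_map fun j => (hX.measurable i j).aemeasurable, stdNormal_map_smul]
  congr 1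
  ext1 j
  rw [(hX.gaussian i j).map_eq, hi]

lemma IsSample.measurable_row (hX : IsSample P X μ σ) (i : Fin m) :
    Measurable fun ω j => X i j ω :=
  measurable_pi_lambda _ fun j => hX.measurable i j

lemma IsSample.measure_row (hX : IsSample P X μ σ) {i : Fin m} (hi : μ i = 0)
    {E : Set (Fin n → ℝ)} (hE : MeasurableSet E) :
    P {ω | (fun j => X i j ω) ∈ E} = stdNormal n {z | σ • z ∈ E} := by
  have h := congrArg (fun ν : Measure (Fin n → ℝ) => ν E) (hX.map_row hi)
  rwa [Measure.map_apply (hX.measurable_row i) hE, Measure.map_apply (by fun_prop) hE] at h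

lemma mul_sq_lt_sumSq_smul_iff (hσ : 0 < σ) (c u : ℝ) (z : Fin n → ℝ) :
    c * σ ^ 2 * u < sumSq (σ • z) ↔ c * u < sumSq z := by
  rw [sumSq_smul, show c * σ ^ 2 * u = σ ^ 2 * (c * u) by ring,
    mul_lt_mul_iff_right₀ (by positivity)]

/-- For a true null, the t-test is independent of the selection step. -/
lemma IsSample.measure_select_reject (hX : IsSample P X μ σ) (hσ : 0 < σ) (hn : n ≠ 0)
    {i : Fin m} (hi : μ i = 0) (c u t : ℝ) :
    P {ω | c * σ ^ 2 * u < sumSq (fun j => X i j ω) ∧ t < |tStat fun j => X i j ω|}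
      = stdNormal n {z | t < |tStat z|} * stdNormal n {z | c * u < sumSq z} := by
  have hA : MeasurableSet {z : Fin n → ℝ | t < |tStat z|} :=
    measurableSet_lt measurable_const (by simpa using measurable_tStat.abs)
  rw [← stdNormal_cone_inter hn hA fun a ha z => by simp [tStat_smul ha]]
  refine (hX.measure_row hi
    (E := {z | c * σ ^ 2 * u < sumSq z ∧ t < |tStat z|})
    ((measurableSet_lt_sumSq _).inter hA)).trans ?_
  congr 1
  ext z
  simp only [Set.mem_ofPred_eq, Set.mem_inter_iff, mul_sq_lt_sumSq_smul_iff hσ, tStat_smul hσ]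
  exact and_comm

lemma IsSample.measure_select_between (hX : IsSample P X μ σ) (hσ : 0 < σ)
    {i : Fin m} (hi : μ i = 0) {c₁ c₂ u : ℝ} (hc : c₁ ≤ c₂) (hu : 0 ≤ u) :
    P {ω | c₁ * σ ^ 2 * u < sumSq (fun j => X i j ω) ∧
        ¬ c₂ * σ ^ 2 * u < sumSq (fun j => X i j ω)}
      = stdNormal n {z | c₁ * u < sumSq z} - stdNormal n {z | c₂ * u < sumSq z} := by
  have hsub : {z : Fin n → ℝ | c₂ * u < sumSq z} ⊆ {z | c₁ * u < sumSq z} := fun z hz =>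
    lt_of_le_of_lt (mul_le_mul_of_nonneg_right hc hu) hz
  rw [← measure_sdiff hsub (measurableSet_lt_sumSq _).nullMeasurableSet (measure_ne_top _ _)]
  refine (hX.measure_row hi (E := {z | c₁ * σ ^ 2 * u < sumSq z ∧ ¬ c₂ * σ ^ 2 * u < sumSq z})
    ((measurableSet_lt_sumSq _).inter (measurableSet_lt_sumSq _).compl)).trans ?_
  congr 1
  ext z
  simp only [Set.mem_ofPred_eq, Set.mem_sdiff, mul_sq_lt_sumSq_smul_iff hσ]

lemma mem_trueNulls {i : Fin m} : i ∈ trueNulls μ ↔ μ i = 0 := by simp [trueNulls]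

lemma mem_selected {x : Fin m → Fin n → ℝ} {c : ℝ} {i : Fin m} :
    i ∈ selected x c ↔ c < sumSq (x i) := by simp [selected]

lemma selectedTrueNulls_eq_sum (γ c : ℝ) (x : Fin m → Fin n → ℝ) :
    (selectedTrueNulls γ μ σ c x : ℝ≥0∞) = ∑ i ∈ trueNulls μ,
      Set.indicator {y : Fin n → ℝ | c * σ ^ 2 * selThreshold m n γ < sumSq y} 1 (x i) := by
  rw [selectedTrueNulls, ← Finset.filter_mem_eq_inter, Finset.card_filter]
  push_cast
  refine Finset.sum_congr rfl fun i _ => ?_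
  simp [Set.indicator_apply, mem_selected]

/-- Markov bound for the number of true nulls selected at the cutoff factor `c₁` but not at `c₂`. -/
lemma IsSample.measure_selectedTrueNulls_sub_ge_le (hX : IsSample P X μ σ) (hσ : 0 < σ)
    {γ c₁ c₂ d : ℝ} (hc : c₁ ≤ c₂) (hu : 0 ≤ selThreshold m n γ) (hd : 0 < d) :
    P {ω | (selectedTrueNulls γ μ σ c₂ (fun i j => X i j ω) : ℝ) + d
        ≤ selectedTrueNulls γ μ σ c₁ (fun i j => X i j ω)}
      ≤ (trueNulls μ).card * (stdNormal n {z | c₁ * selThreshold m n γ < sumSq z}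
        - stdNormal n {z | c₂ * selThreshold m n γ < sumSq z}) / ENNReal.ofReal d := by
  classical
  set u := selThreshold m n γ with hu'
  let E : Set (Fin n → ℝ) := {z | c₁ * σ ^ 2 * u < sumSq z ∧ ¬ c₂ * σ ^ 2 * u < sumSq z}
  have hE : MeasurableSet E :=
    (measurableSet_lt_sumSq _).inter (measurableSet_lt_sumSq _).compl
  have hind : ∀ i, Measurable fun ω => E.indicator (1 : (Fin n → ℝ) → ℝ≥0∞) (fun j => X i j ω) :=
    fun i => (measurable_one.indicator hE).comp (hX.measurable_row i)
  have hcount : ∀ ω, (selectedTrueNulls γ μ σ c₁ (fun i j => X i j ω) : ℝ≥0∞)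
      ≤ selectedTrueNulls γ μ σ c₂ (fun i j => X i j ω)
        + ∑ i ∈ trueNulls μ, E.indicator (1 : (Fin n → ℝ) → ℝ≥0∞) (fun j => X i j ω) := by
    intro ω
    rw [selectedTrueNulls_eq_sum, selectedTrueNulls_eq_sum, ← Finset.sum_add_distrib]
    refine Finset.sum_le_sum fun i _ => ?_
    by_cases h1 : c₁ * σ ^ 2 * u < sumSq fun j => X i j ω <;>
    by_cases h2 : c₂ * σ ^ 2 * u < sumSq fun j => X i j ω <;>
    simp [E, h1, h2, ← hu', -not_lt]
  have hint : ∫⁻ ω, ∑ i ∈ trueNulls μ, E.indicator (1 : (Fin n → ℝ) → ℝ≥0∞)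
      (fun j => X i j ω) ∂P = (trueNulls μ).card * (stdNormal n {z | c₁ * u < sumSq z}
        - stdNormal n {z | c₂ * u < sumSq z}) := by
    rw [lintegral_finsetSum _ fun i _ => hind i, Finset.sum_congr rfl (g := fun _ =>
      stdNormal n {z | c₁ * u < sumSq z} - stdNormal n {z | c₂ * u < sumSq z})]
    · simp
    · intro i hi
      rw [← hX.measure_select_between hσ (mem_trueNulls.1 hi) hc hu]
      exact lintegral_indicator_one (hX.measurable_row i hE)
  rw [← hint]
  refine le_trans (measure_mono fun ω hω => ?_) (meas_ge_le_lintegral_div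
    (Finset.measurable_sum _ fun i _ => hind i).aemeasurable (by simpa using hd) (by simp))
  have h : (selectedTrueNulls γ μ σ c₂ (fun i j => X i j ω) : ℝ≥0∞) + ENNReal.ofReal d
      ≤ selectedTrueNulls γ μ σ c₁ (fun i j => X i j ω) := by
    rw [← ENNReal.ofReal_natCast, ← ENNReal.ofReal_natCast,
      ← ENNReal.ofReal_add (Nat.cast_nonneg _) hd.le]
    exact ENNReal.ofReal_le_ofReal hω
  exact (ENNReal.add_le_add_iff_left (ENNReal.natCast_ne_top _)).1 (h.trans (hcount ω))

/-- With cutoff and level both deterministic, the two stages are independent for each null and the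
union bound finishes. -/
lemma IsSample.measure_exists_trueNull_le (hX : IsSample P X μ σ) (hσ : 0 < σ) (hn : 2 ≤ n)
    (c u : ℝ) {β : ℝ} (hβ : 0 < β) :
    P {ω | ∃ i ∈ trueNulls μ, c * σ ^ 2 * u < sumSq (fun j => X i j ω) ∧
        quantile (studentT (n - 1)) (1 - β / 2) < |tStat fun j => X i j ω|}
      ≤ (trueNulls μ).card * (ENNReal.ofReal β * stdNormal n {z | c * u < sumSq z}) := by
  have hU : {ω | ∃ i ∈ trueNulls μ, c * σ ^ 2 * u < sumSq (fun j => X i j ω) ∧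
        quantile (studentT (n - 1)) (1 - β / 2) < |tStat fun j => X i j ω|}
      = ⋃ i ∈ trueNulls μ, {ω | c * σ ^ 2 * u < sumSq (fun j => X i j ω) ∧
        quantile (studentT (n - 1)) (1 - β / 2) < |tStat fun j => X i j ω|} := by
    ext ω
    simp only [Set.mem_ofPred_eq, Set.mem_iUnion, exists_prop]
  rw [hU]
  refine (measure_biUnion_finset_le _ _).trans ?_
  rw [← nsmul_eq_mul]
  refine Finset.sum_le_card_nsmul _ _ _ fun i hi => ?_
  rw [hX.measure_select_reject hσ (by omega) (mem_trueNulls.1 hi)]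
  gcongr
  exact stdNormal_tStat_le hn hβ

/-- A finite-sample bound for the familywise error rate. -/
lemma IsSample.FWER_le (hX : IsSample P X μ σ) (hσ : 0 < σ) (hn : 2 ≤ n) {γ α : ℝ}
    (hα : 0 < α) (s : Ω → ℝ) (hu : 0 ≤ selThreshold m n γ) {δ K d : ℝ} (hδ : 0 ≤ δ) (hd : 0 < d)
    (hK : d < K) (hαK : α < 2 * (K - d)) :
    FWER P γ α μ X s ≤ P {ω | δ * σ ^ 2 < |s ω - σ ^ 2|}
      + P {ω | (selectedTrueNulls γ μ σ (1 - δ) (fun i j => X i j ω) : ℝ) < K}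
      + (trueNulls μ).card * (stdNormal n {z | (1 - δ) * selThreshold m n γ < sumSq z}
        - stdNormal n {z | (1 + δ) * selThreshold m n γ < sumSq z}) / ENNReal.ofReal d
      + (trueNulls μ).card * (ENNReal.ofReal (α / (K - d))
        * stdNormal n {z | (1 - δ) * selThreshold m n γ < sumSq z}) := by
  set u := selThreshold m n γ with hu'
  have hL : 0 < K - d := by linarith
  -- The bad events, in the order of the four terms: inaccurate variance estimate, too few nulls at
  -- `1 - δ`, too many lost between the two factors, and a null that passes the loosened cutoff and
  -- a deterministic critical value.
  refine le_trans (measure_mono (t := {ω | δ * σ ^ 2 < |s ω - σ ^ 2|}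
      ∪ {ω | (selectedTrueNulls γ μ σ (1 - δ) (fun i j => X i j ω) : ℝ) < K}
      ∪ {ω | (selectedTrueNulls γ μ σ (1 + δ) (fun i j => X i j ω) : ℝ) + d
        ≤ selectedTrueNulls γ μ σ (1 - δ) (fun i j => X i j ω)}
      ∪ {ω | ∃ i ∈ trueNulls μ, (1 - δ) * σ ^ 2 * u < sumSq (fun j => X i j ω) ∧
        quantile (studentT (n - 1)) (1 - α / (K - d) / 2) < |tStat fun j => X i j ω|}) ?_)
    ((measure_union_le _ _).trans (add_le_add ((measure_union_le _ _).trans (add_le_add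
      (measure_union_le _ _) (hX.measure_selectedTrueNulls_sub_ge_le hσ (by linarith) hu hd)))
      (hX.measure_exists_trueNull_le hσ hn _ _ (by positivity))))
  rintro ω ⟨i, hi, hrej⟩
  by_contra hnot
  simp only [Set.mem_union, Set.mem_ofPred_eq, not_or, not_lt, not_le] at hnot
  obtain ⟨⟨⟨h1, h2⟩, h3⟩, h4⟩ := hnot
  refine h4 ⟨i, hi, ?_⟩
  rw [abs_le] at h1
  simp only [rejected, Finset.mem_filter, mem_selected] at hrej
  obtain ⟨hsel, ht⟩ := hrej
  refine ⟨lt_of_le_of_lt (mul_le_mul_of_nonneg_right (by linarith) hu) hsel, lt_of_le_of_lt ?_ ht⟩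
  set N := (selected (fun i j => X i j ω) (s ω * selThreshold m n γ)).card with hN
  have hle : selectedTrueNulls γ μ σ (1 + δ) (fun i j => X i j ω) ≤ N := by
    refine Finset.card_le_card fun k hk => ?_
    have hk' := mem_selected.1 (Finset.mem_inter.1 hk).2
    exact mem_selected.2 (lt_of_le_of_lt (mul_le_mul_of_nonneg_right (by linarith) hu) hk')
  -- Outside the second and third bad events the divisor is at least `K - d`, so the actual critical
  -- value is at least the deterministic one.
  have hle' : K - d ≤ N := by
    have : (selectedTrueNulls γ μ σ (1 + δ) (fun i j => X i j ω) : ℝ) ≤ N := by exact_mod_cast hle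
    linarith
  have hNpos : (0 : ℝ) < N := hL.trans_le hle'
  refine quantile_mono ?_ ?_ ?_
  -- `hαK` keeps the smaller order positive, away from the default values of `sInf`.
  · rw [div_div, sub_pos, div_lt_one (by positivity)]; linarith
  · rw [div_div, mul_comm (K - d)]
    gcongr
  · have : 0 < α / (2 * (N : ℝ)) := by positivity
    linarith

end FiniteSample

/-! ### Tail bounds at the selection threshold -/

section SelectionThreshold

variable {m n : ℕ} {γ : ℝ}

lemma one_sub_rpow_nonneg (hm : 1 ≤ m) (hγ : γ ≤ 1) : 0 ≤ 1 - (m : ℝ) ^ (γ - 1) :=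
  sub_nonneg.2 (Real.rpow_le_one_of_one_le_of_nonpos (by exact_mod_cast hm) (by linarith))

lemma selThreshold_nonneg (hm : 1 ≤ m) (hn : n ≠ 0) (hγ : γ ≤ 1) : 0 ≤ selThreshold m n γ :=
  quantile_chiSquared_nonneg hn (one_sub_rpow_nonneg hm hγ)

lemma stdNormal_selThreshold_lt (hm : 1 ≤ m) (hn : n ≠ 0) (hγ : γ ≤ 1) :
    stdNormal n {z | selThreshold m n γ < sumSq z} = ENNReal.ofReal ((m : ℝ) ^ (γ - 1)) := by
  have hpos : 0 < (m : ℝ) ^ (γ - 1) := Real.rpow_pos_of_pos (by exact_mod_cast hm) _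
  rw [selThreshold, stdNormal_quantile_lt hn (one_sub_rpow_nonneg hm hγ) (by linarith),
    sub_sub_cancel]

/-- The order of the relative error of the selection probability when the cutoff factor is
perturbed by `ρ / √n`. -/
def tailError (m : ℕ) (γ ρ : ℝ) : ℝ := 2 * ρ * ((1 - γ) * Real.log m) + ρ / 2

/-- The selection probability `m ^ (γ - 1)` over the divisor `m ^ γ` leaves `1 / m`, so the nulls
enter only through `N / m`, which has a limit. -/
lemma card_mul_tail_le (hm : 1 ≤ m) (hn : 2 ≤ n) (hγ : γ ≤ 1) {ρ : ℝ} (hρ0 : 0 ≤ ρ)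
    (hρ : ρ ≤ 1 / 2) (N : ℕ) {β : ℝ} (hβ : 0 < β) :
    (N : ℝ≥0∞) * (ENNReal.ofReal (β / (m : ℝ) ^ γ)
        * stdNormal n {z | (1 - ρ / √n) * selThreshold m n γ < sumSq z})
      ≤ ENNReal.ofReal (N / m * (β * Real.exp (tailError m γ ρ))) := by
  have hm0 : (0 : ℝ) < m := by exact_mod_cast hm
  have hq := Real.rpow_pos_of_pos hm0 (γ - 1)
  have hg := Real.rpow_pos_of_pos hm0 γ
  have h := stdNormal_tail_shrink_le hn hρ0 hρ hq (stdNormal_selThreshold_lt hm (by omega) hγ)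
  refine (mul_le_mul_right (mul_le_mul_right h _) _).trans (le_of_eq ?_)
  rw [← ENNReal.ofReal_natCast, ← ENNReal.ofReal_mul (by positivity),
    ← ENNReal.ofReal_mul (by positivity)]
  congr 1
  rw [Real.log_rpow hm0, tailError, Real.rpow_sub_one hm0.ne',
    show 2 * ρ * -((γ - 1) * Real.log m) = 2 * ρ * ((1 - γ) * Real.log m) by ring]
  field_simp

lemma card_mul_tail_sub_le (hm : 1 ≤ m) (hn : 2 ≤ n) (hγ : γ ≤ 1) {ρ : ℝ} (hρ0 : 0 ≤ ρ)
    (hρ : ρ ≤ 1 / 2) (N : ℕ) {β : ℝ} (hβ : 0 < β) :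
    (N : ℝ≥0∞) * (stdNormal n {z | (1 - ρ / √n) * selThreshold m n γ < sumSq z}
        - stdNormal n {z | (1 + ρ / √n) * selThreshold m n γ < sumSq z})
          / ENNReal.ofReal (β * (m : ℝ) ^ γ)
      ≤ ENNReal.ofReal (N / m * ((Real.exp (tailError m γ ρ)
        - Real.exp (-tailError m γ ρ - ρ ^ 2)) / β)) := by
  have hm0 : (0 : ℝ) < m := by exact_mod_cast hm
  have hq := Real.rpow_pos_of_pos hm0 (γ - 1)
  have hg := Real.rpow_pos_of_pos hm0 γ
  have hu := stdNormal_selThreshold_lt (n := n) hm (by omega) hγ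
  have h1 := stdNormal_tail_shrink_le hn hρ0 hρ hq hu
  have h2 := le_stdNormal_tail_enlarge hn hρ0 hρ hq hu
  have h3 := tsub_le_tsub h1 h2
  rw [← ENNReal.ofReal_sub _ (by positivity), Real.log_rpow hm0,
    show 2 * ρ * -((γ - 1) * Real.log m) + ρ / 2 = tailError m γ ρ by rw [tailError]; ring] at h3
  refine (ENNReal.div_le_div_right (mul_le_mul_right h3 _) _).trans (le_of_eq ?_)
  rw [← ENNReal.ofReal_natCast, ← ENNReal.ofReal_mul (by positivity),
    ← ENNReal.ofReal_div_of_pos (by positivity)]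
  congr 1
  rw [Real.rpow_sub_one hm0.ne']
  field_simp

end SelectionThreshold

/-! ### Passage to the limit -/

section Asymptotics

variable {Ω : ℕ → Type*} [∀ m, MeasurableSpace (Ω m)] {P : ∀ m, Measure (Ω m)}

/-- A sequence which is `O_P(r)` is negligible with respect to any sequence dominating `r`. -/
lemma IsBigOP.tendsto_measure_lt_abs {Y : ∀ m, Ω m → ℝ} {r s : ℕ → ℝ} (hY : IsBigOP P Y r)
    (hrs : ∀ M : ℝ, ∀ᶠ m in atTop, M * r m ≤ s m) :
    Tendsto (fun m => P m {ω | s m < |Y m ω|}) atTop (𝓝 0) := by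
  rw [ENNReal.tendsto_nhds_zero]
  intro ε hε
  obtain ⟨e, he0, heε⟩ := ENNReal.lt_iff_exists_real_btwn.1 hε
  obtain ⟨M, hM⟩ := hY e (by simpa using heε.1)
  filter_upwards [hM, hrs M] with m h1 h2
  exact (measure_mono fun ω hω => lt_of_le_of_lt h2 hω).trans (h1.trans heε.2.le)

lemma tendsto_div_sqrt_zero {τ : ℕ → ℝ} (hτ : Tendsto τ atTop atTop)
    (h : Tendsto (fun m : ℕ => τ m * Real.log m / √(m : ℝ)) atTop (𝓝 0)) :
    Tendsto (fun m : ℕ => τ m / √(m : ℝ)) atTop (𝓝 0) := by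
  refine squeeze_zero' ?_ ?_ h
  · filter_upwards [hτ.eventually_ge_atTop 0] with m hm
    positivity
  · have hlog : Tendsto (fun m : ℕ => Real.log m) atTop atTop :=
      Real.tendsto_log_atTop.comp tendsto_natCast_atTop_atTop
    filter_upwards [hτ.eventually_ge_atTop 0, hlog.eventually_ge_atTop 1] with m hm hl
    gcongr
    exact le_mul_of_one_le_right hm hl

end Asymptotics

/-- The familywise error rate is asymptotically bounded by `α / (1 - 2 ε)` for every small `ε`. -/
lemma limsup_FWER_le {Ω : ℕ → Type*} [∀ m, MeasurableSpace (Ω m)]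
    {P : ∀ m, Measure (Ω m)} [∀ m, IsProbabilityMeasure (P m)]
    {n : ℕ → ℕ} (hn : ∀ m, 2 ≤ n m)
    {σ : ℝ} (hσ : 0 < σ) {μ : ∀ m, Fin m → ℝ}
    {X : ∀ m, Fin m → Fin (n m) → Ω m → ℝ} (hX : ∀ m, IsSample (P m) (X m) (μ m) σ)
    {sigmaSqHat : ∀ m, Ω m → ℝ} {γ : ℝ} (hγ₀ : 0 < γ) (hγ₁ : γ ≤ 1) {α : ℝ} (hα₀ : 0 < α)
    {π₀ : ℝ} (hπ₀ : 0 < π₀)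
    (hnulls : Tendsto (fun m : ℕ => ((trueNulls (μ m)).card : ℝ) / m) atTop (𝓝 π₀))
    (hhat : IsBigOP P (fun m ω => sigmaSqHat m ω - σ ^ 2) (fun m => 1 / √((m : ℝ) * n m)))
    {τ : ℕ → ℝ} (hτ : Tendsto τ atTop atTop)
    (hτlog : Tendsto (fun m : ℕ => τ m * Real.log m / √(m : ℝ)) atTop (𝓝 0))
    (hcount : TendstoInProb P
      (fun m ω => (selectedTrueNulls γ (μ m) σ (1 - τ m / √((m : ℝ) * n m))
        (fun i j => X m i j ω) : ℝ) / (m : ℝ) ^ γ) π₀)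
    {ε : ℝ} (hε₀ : 0 < ε) (hε₁ : ε < 1 / 2) :
    limsup (fun m => FWER (P m) γ α (μ m) (X m) (sigmaSqHat m)) atTop
      ≤ ENNReal.ofReal (α / (1 - 2 * ε)) := by
  -- Splitting `√(m n)` leaves `ρ` free of `n`, so no growth condition on `n` is needed.
  set ρ : ℕ → ℝ := fun m => τ m / √(m : ℝ) with hρ
  have hρ0 : Tendsto ρ atTop (𝓝 0) := tendsto_div_sqrt_zero hτ hτlog
  have hδ : ∀ m, τ m / √((m : ℝ) * n m) = ρ m / √(n m : ℝ) := fun m => by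
    rw [hρ, Real.sqrt_mul (Nat.cast_nonneg m), div_div]
  -- The slow growth of `τ` enters here: `ρ m * log m → 0`.
  have herr : Tendsto (fun m => tailError m γ (ρ m)) atTop (𝓝 0) := by
    have := ((hτlog.const_mul (2 * (1 - γ))).add (hρ0.div_const 2))
    simp only [mul_zero, zero_div, add_zero] at this
    refine this.congr fun m => ?_
    rw [tailError, hρ]
    ring
  have hmγ : Tendsto (fun m : ℕ => (m : ℝ) ^ γ) atTop atTop :=
    (tendsto_rpow_atTop hγ₀).comp tendsto_natCast_atTop_atTop
  have t1 : Tendsto (fun m => P m {ω | ρ m / √(n m : ℝ) * σ ^ 2 < |sigmaSqHat m ω - σ ^ 2|})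
      atTop (𝓝 0) := by
    refine hhat.tendsto_measure_lt_abs fun M => ?_
    filter_upwards [hτ.eventually_ge_atTop (M / σ ^ 2)] with m hm
    rw [← hδ, mul_one_div, div_mul_eq_mul_div]
    gcongr
    rwa [div_le_iff₀ (by positivity)] at hm
  have t2 := hcount (ε * π₀) (by positivity)
  have t3 : Tendsto (fun m => ENNReal.ofReal (((trueNulls (μ m)).card : ℝ) / m *
      ((Real.exp (tailError m γ (ρ m)) - Real.exp (-tailError m γ (ρ m) - ρ m ^ 2)) / (ε * π₀))))
      atTop (𝓝 0) := by
    rw [← ENNReal.ofReal_zero]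
    refine ENNReal.tendsto_ofReal ?_
    have := hnulls.mul (((Real.continuous_exp.tendsto _).comp herr).sub
      ((Real.continuous_exp.tendsto _).comp (herr.neg.sub (hρ0.pow 2))) |>.div_const (ε * π₀))
    simpa using this
  have t4 : Tendsto (fun m => ENNReal.ofReal (((trueNulls (μ m)).card : ℝ) / m *
      (α / ((1 - 2 * ε) * π₀) * Real.exp (tailError m γ (ρ m)))))
      atTop (𝓝 (ENNReal.ofReal (α / (1 - 2 * ε)))) := by
    refine ENNReal.tendsto_ofReal ?_
    have := hnulls.mul (((Real.continuous_exp.tendsto _).comp herr).const_mul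
      (α / ((1 - 2 * ε) * π₀)))
    have e : π₀ * (α / ((1 - 2 * ε) * π₀) * Real.exp 0) = α / (1 - 2 * ε) := by
      have : 1 - 2 * ε ≠ 0 := by linarith
      rw [Real.exp_zero]; field_simp
    rwa [e] at this
  have hlim := ((t1.add t2).add t3).add t4
  simp only [zero_add] at hlim
  rw [← hlim.limsup_eq]
  refine limsup_le_limsup ?_
  have hε2 : 0 < 1 - 2 * ε := by linarith
  filter_upwards [eventually_ge_atTop 1, hτ.eventually_ge_atTop 0,
    hρ0.eventually (ge_mem_nhds (show (0 : ℝ) < 1 / 2 by norm_num)),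
    hmγ.eventually_gt_atTop (α / (2 * ((1 - 2 * ε) * π₀)))] with m hm hτm hρm hbig
  have hm0 : (0 : ℝ) < m := by exact_mod_cast hm
  have hg := Real.rpow_pos_of_pos hm0 γ
  have hρnn : 0 ≤ ρ m := by simp only [hρ]; positivity
  have hL : (1 - ε) * π₀ * (m : ℝ) ^ γ - ε * π₀ * (m : ℝ) ^ γ
      = (1 - 2 * ε) * π₀ * (m : ℝ) ^ γ := by ring
  have hLpos : 0 < (1 - 2 * ε) * π₀ * (m : ℝ) ^ γ := by positivity
  -- One `ε` pays for the deviation of the null count from `π₀ m ^ γ`, the other for the nulls lost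
  -- between the factors.
  have hsz := (hX m).FWER_le hσ (hn m) hα₀ (sigmaSqHat m)
    (selThreshold_nonneg hm (by have := hn m; omega) hγ₁)
    (δ := ρ m / √(n m : ℝ)) (K := (1 - ε) * π₀ * (m : ℝ) ^ γ) (d := ε * π₀ * (m : ℝ) ^ γ)
    (by positivity) (by positivity) (by linarith) (by
      rw [hL]
      rw [div_lt_iff₀ (by positivity)] at hbig
      linarith)
  refine hsz.trans ?_
  refine add_le_add (add_le_add (add_le_add le_rfl ?_) ?_) ?_
  · refine measure_mono fun ω hω => ?_
    have hω' : (selectedTrueNulls γ (μ m) σ (1 - ρ m / √(n m : ℝ)) (fun i j => X m i j ω) : ℝ)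
      < (1 - ε) * π₀ * (m : ℝ) ^ γ := hω
    rw [← div_lt_iff₀ hg, ← hδ] at hω'
    change ε * π₀ ≤ |_ - π₀|
    refine le_abs.2 (Or.inr ?_)
    linarith
  · exact card_mul_tail_sub_le hm (hn m) hγ₁ hρnn hρm _ (by positivity)
  · rw [hL, ← div_div]
    exact card_mul_tail_le hm (hn m) hγ₁ hρnn hρm _ (by positivity)

end TwoStage
end

theorem theorem6p2 {Ω : ℕ → Type*} [∀ m, MeasurableSpace (Ω m)]
    (P : ∀ m, Measure (Ω m)) [∀ m, IsProbabilityMeasure (P m)]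
    (n : ℕ → ℕ) (hn : ∀ m, 2 ≤ n m)
    (σ : ℝ) (hσ : 0 < σ) (μ : ∀ m, Fin m → ℝ)
    (X : ∀ m, Fin m → Fin (n m) → Ω m → ℝ)
    (hX : ∀ m, TwoStage.IsSample (P m) (X m) (μ m) σ)
    (sigmaSqHat : ∀ m, Ω m → ℝ) (hmeas : ∀ m, Measurable (sigmaSqHat m))
    (γ : ℝ) (hγ₀ : 0 < γ) (hγ₁ : γ ≤ 1) (α : ℝ) (hα₀ : 0 < α) (hα₁ : α < 1)
    (π₀ : ℝ) (hπ₀ : 0 < π₀) (hπ₁ : π₀ ≤ 1)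
    (hB1 : Tendsto (fun m : ℕ => ((TwoStage.trueNulls (μ m)).card : ℝ) / m) atTop (𝓝 π₀))
    (hB3 : TwoStage.IsBigOP P (fun m ω => sigmaSqHat m ω - σ ^ 2)
      (fun m => 1 / √((m : ℝ) * n m)))
    (hB4 : ∃ τ : ℕ → ℝ, Tendsto τ atTop atTop ∧
      Tendsto (fun m : ℕ => τ m * Real.log m / √(m : ℝ)) atTop (𝓝 0) ∧
      TwoStage.TendstoInProb P
        (fun m ω => (TwoStage.selectedTrueNulls γ (μ m) σ (1 - τ m / √((m : ℝ) * n m))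
          (fun i j => X m i j ω) : ℝ) / (m : ℝ) ^ γ) π₀) :
    limsup (fun m => TwoStage.FWER (P m) γ α (μ m) (X m) (sigmaSqHat m)) atTop
      ≤ ENNReal.ofReal α := by
  obtain ⟨τ, hτ, hτlog, hcount⟩ := hB4
  have hlim : Tendsto (fun ε : ℝ => ENNReal.ofReal (α / (1 - 2 * ε))) (𝓝[>] 0)
      (𝓝 (ENNReal.ofReal α)) := by
    refine ENNReal.tendsto_ofReal ?_
    have h : ContinuousAt (fun ε : ℝ => α / (1 - 2 * ε)) 0 :=
      continuousAt_const.div (by fun_prop) (by norm_num)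
    simpa using h.tendsto.mono_left nhdsWithin_le_nhds
  refine ge_of_tendsto hlim ?_
  filter_upwards [Ioo_mem_nhdsGT (show (0 : ℝ) < 1 / 2 by norm_num)] with ε hε
  exact TwoStage.limsup_FWER_le hn hσ hX hγ₀ hγ₁ hα₀ hπ₀ hB1 hB3 hτ hτlog hcount hε.1 hε.2
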